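/- Let $(Q,\leq_Q)$ be a quasi-order, whose elements we regard as urelements, and let $V(Q)$ be the class of all sets built over these urelements (urelements included). Put $\mathrm{rk}(x)\le\alpha$ iff $\mathrm{rk}(y)<\alpha$ for every $y\in x$ that is not a urelement; the rank is undefined at urelements. Define the quasi-order $\lesssim^*$ on $V(Q)$ by recursion: for $x,y\in Q$, $x\lesssim^* y$ iff $x\le_Q y$; for $x\notin Q$, $y\in Q$, $x\lesssim^* y$ iff $x\lesssim^*\{y\}$; for $x\in Q$, $y\notin Q$, $x\lesssim^* y$ iff $\{x\}\lesssim^* y$; and for $x,y\notin Q$, $x\lesssim^* y$ iff $\forall x'\in x\,\exists y'\in y\; x'\lesssim^* y'$. By recursion on the ordinal $\alpha$, let $\dot I^*_\alpha(Q)$, ordered by $\lesssim^*$, consist of all urelements together with all sets $x$ such that $x$ has rank $<\alpha$, $x$ contains a urelement in its transitive closure, every $x'\in x$ belongs to $\dot I^*_\beta(Q)$ for some $\beta<\alpha$, and for all $y,z\in x$ there is $w\in x$ with $y,z\lesssim^* w$. For finite $\sigma\subseteq\mathbb N$ and any $X\subseteq\mathbb N$, write $\sigma\sqsubseteq X$ if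 $\sigma$ is an initial segment of $X$ (in increasing order). A front is a pair $(F,\mathrm{rk}_F)$ where $F$ is an infinite $\sqsubseteq$-antichain of finite subsets of $\mathbb N$ such that every infinite $X\subseteq\bigcup F$ has some $\sigma\in F$ with $\sigma\sqsubseteq X$, and $\mathrm{rk}_F$ is an ordinal-valued function on the set $T_F$ of proper initial segments of members of $F$ with $\mathrm{rk}_F(\sigma)>\mathrm{rk}_F(\tau)$ whenever $\sigma\sqsubsetneq\tau$ in $T_F$; its rank is $\mathrm{rk}_F(\emptyset)$. For non-empty finite $\sigma,\tau\subseteq\mathbb N$, $\sigma\triangleleft\tau$ means that $\min\sigma<\min\tau$ and $\sigma\setminus\{\min\sigma\}$ is $\sqsubseteq$-comparable with $\tau$. A function $g\colon F\to Q$ on a front (an array, of rank the rank of $F$) is bad if $g(\sigma)\not\le_Q g(\tau)$ for all $\sigma,\tau\in F$ with $\sigma\triangleleft\tau$. A quasi-order is a wqo if for every infinite sequence $(x_n)$ in it there are $m<n$ with $x_m\le x_n$. $Q$ is an $\alpha$-wqo if it is well-founded and there are no bad arrays of rank $<\alpha$ into $Q$; it is a bqo if it is an $\alpha$-wqo for every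 ordinal $\alpha$. Theorem. For every ordinal $\alpha$, $\dot I^*_\alpha(Q)$ is a wqo if and only if there are no bad arrays $g\colon F\to Q$ where $F$ is a front of rank $\le\alpha$. Hence $Q$ is a bqo if and only if $\dot I^*_\alpha(Q)$ is a wqo for every ordinal $\alpha$. -/

import Mathlib

universe u v

namespace IterIdeal

/-! ### Sets over a class of urelements

`USet.{u, v} Q` is the class `V(Q)` of all (well-founded, extensional) sets built over the
urelements `q : Q`. It is constructed as Mathlib constructs `ZFSet` from `PSet`. Sets are the
families indexed by types in universe `v`; the ordinals are those in `Ordinal.{v}`. The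
type `Q` lives in an arbitrary universe `u`, so it may or may not be small relative to `v`. -/

/-- Codes for sets with urelements from `Q`. -/
inductive PreUSet (Q : Type u) : Type (max u (v + 1))
  | atom (q : Q) : PreUSet Q
  | mk (ι : Type v) (f : ι → PreUSet Q) : PreUSet Q

namespace PreUSet

variable {Q : Type u}

/-- Extensional equality of codes. -/
def Equiv : PreUSet.{u, v} Q → PreUSet.{u, v} Q → Prop
  | atom p, atom q => p = q
  | mk _ f, mk _ g => (∀ i, ∃ j, Equiv (f i) (g j)) ∧ ∀ j, ∃ i, Equiv (f i) (g j)
  | atom _, mk _ _ => False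
  | mk _ _, atom _ => False

theorem Equiv.refl (x : PreUSet.{u, v} Q) : Equiv x x := by
  induction x with
  | atom q => simp [Equiv]
  | mk ι f ih => exact ⟨fun i => ⟨i, ih i⟩, fun i => ⟨i, ih i⟩⟩

theorem Equiv.symm {x y : PreUSet.{u, v} Q} : Equiv x y → Equiv y x := by
  induction x generalizing y with
  | atom p => cases y <;> simp [Equiv, eq_comm]
  | mk ι f ih =>
    cases y with
    | atom q => simp [Equiv]
    | mk κ g =>
      rintro ⟨h₁, h₂⟩
      exact ⟨fun j => (h₂ j).imp fun i h => ih i h, fun i => (h₁ i).imp fun j h => ih i h⟩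

theorem Equiv.trans {x y z : PreUSet.{u, v} Q} : Equiv x y → Equiv y z → Equiv x z := by
  induction x generalizing y z with
  | atom p => cases y <;> cases z <;> simp +contextual [Equiv]
  | mk ι f ih =>
    cases y with
    | atom q => simp [Equiv]
    | mk κ g =>
      cases z with
      | atom q => simp [Equiv]
      | mk μ h =>
        rintro ⟨h₁, h₂⟩ ⟨h₃, h₄⟩
        refine ⟨fun i => ?_, fun k => ?_⟩
        · obtain ⟨j, hj⟩ := h₁ i
          obtain ⟨k, hk⟩ := h₃ j
          exact ⟨k, ih i hj hk⟩
        · obtain ⟨j, hj⟩ := h₄ k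
          obtain ⟨i, hi⟩ := h₂ j
          exact ⟨i, ih i hi hj⟩

instance setoid (Q : Type u) : Setoid (PreUSet.{u, v} Q) :=
  ⟨Equiv, Equiv.refl, Equiv.symm, Equiv.trans⟩

/-- `x ∈ y`; urelements have no elements. -/
def Mem (x : PreUSet.{u, v} Q) : PreUSet.{u, v} Q → Prop
  | atom _ => False
  | mk _ f => ∃ i, Equiv x (f i)

theorem mem_congr {x x' y y' : PreUSet.{u, v} Q} (hx : Equiv x x') (hy : Equiv y y') :
    Mem x y ↔ Mem x' y' := by
  cases y <;> cases y' <;> simp only [Mem, Equiv] at *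
  constructor
  · rintro ⟨i, hi⟩
    obtain ⟨j, hj⟩ := hy.1 i
    exact ⟨j, (hx.symm.trans hi).trans hj⟩
  · rintro ⟨j, hj⟩
    obtain ⟨i, hi⟩ := hy.2 j
    exact ⟨i, (hx.trans hj).trans hi.symm⟩

/-- Being a urelement. -/
def IsAtom : PreUSet.{u, v} Q → Prop
  | atom _ => True
  | mk _ _ => False

theorem isAtom_congr {x y : PreUSet.{u, v} Q} (h : Equiv x y) : IsAtom x ↔ IsAtom y := by
  cases x <;> cases y <;> simp_all [IsAtom, Equiv]

open Classical in
/-- The rank: the least ordinal above the ranks of all elements that are not urelements. The value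
`0` at urelements is a placeholder. -/
noncomputable def rank : PreUSet.{u, v} Q → Ordinal.{v}
  | atom _ => 0
  | mk _ f => ⨆ i, if IsAtom (f i) then 0 else Order.succ (rank (f i))

theorem rank_mk_le_iff {ι : Type v} {f : ι → PreUSet.{u, v} Q} {α : Ordinal.{v}} :
    rank (mk ι f) ≤ α ↔ ∀ i, ¬ IsAtom (f i) → rank (f i) < α := by
  classical
  rw [rank, Ordinal.iSup_le_iff]
  refine forall_congr' fun i => ?_
  by_cases h : IsAtom (f i) <;> simp [h]

theorem rank_congr {x y : PreUSet.{u, v} Q} (h : Equiv x y) : rank x = rank y := by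
  induction x generalizing y with
  | atom p => cases y <;> simp_all [Equiv, rank]
  | mk ι f ih =>
    cases y with
    | atom q => simp [Equiv] at h
    | mk κ g =>
      refine eq_of_forall_ge_iff fun α => ?_
      rw [rank_mk_le_iff, rank_mk_le_iff]
      constructor
      · intro H j hj
        obtain ⟨i, hi⟩ := h.2 j
        rw [← ih i hi]
        exact H i fun hc => hj ((isAtom_congr hi).1 hc)
      · intro H i hi
        obtain ⟨j, hj⟩ := h.1 i
        rw [ih i hj]
        exact H j fun hc => hi ((isAtom_congr hj).2 hc)

section Le

variable [Preorder Q]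

/-- The relation `p ≲* y` for a urelement `p`. -/
def AtomLe (p : Q) : PreUSet.{u, v} Q → Prop
  | atom q => p ≤ q
  | mk _ g => ∃ j, AtomLe p (g j)

/-- The relation `x ≲* y`; the defining clauses are recovered, for sets, in `USet.atom_le_atom`,
`USet.le_atom_iff`, `USet.atom_le_iff` and `USet.le_iff`. -/
def Le : PreUSet.{u, v} Q → PreUSet.{u, v} Q → Prop
  | atom p, y => AtomLe p y
  | mk _ f, atom q => ∀ i, Le (f i) (atom q)
  | mk _ f, mk _ g => ∀ i, ∃ j, Le (f i) (g j)

theorem Le.of_equiv {x y : PreUSet.{u, v} Q} (h : Equiv x y) : Le x y := by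
  induction x generalizing y with
  | atom p => cases y <;> simp_all [Equiv, Le, AtomLe]
  | mk ι f ih =>
    cases y with
    | atom q => simp [Equiv] at h
    | mk κ g => exact fun i => (h.1 i).imp fun j hj => ih i hj

theorem AtomLe.of_le {p q : Q} (hpq : p ≤ q) {z : PreUSet.{u, v} Q} (h : AtomLe q z) :
    AtomLe p z := by
  induction z with
  | atom r => exact hpq.trans h
  | mk μ k ih =>
    obtain ⟨j, hj⟩ := h
    exact ⟨j, ih j hj⟩

theorem AtomLe.trans {p : Q} {y z : PreUSet.{u, v} Q} (h : AtomLe p y) (h' : Le y z) :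
    AtomLe p z := by
  induction y generalizing z with
  | atom q => exact AtomLe.of_le h h'
  | mk κ g ih =>
    obtain ⟨j, hj⟩ := h
    cases z with
    | atom r => exact ih j hj (h' j)
    | mk μ k =>
      obtain ⟨l, hl⟩ := h' j
      exact ⟨l, ih j hj hl⟩

theorem Le.trans {x y z : PreUSet.{u, v} Q} (h : Le x y) (h' : Le y z) : Le x z := by
  induction x generalizing y z with
  | atom p => exact AtomLe.trans h h'
  | mk ι f ih =>
    cases y with
    | atom q =>
      cases z with
      | atom r => exact fun i => ih i (h i) h'
      | mk μ k =>
        obtain ⟨l, hl⟩ := h'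
        exact fun i => ⟨l, ih i (h i) hl⟩
    | mk κ g =>
      cases z with
      | atom r =>
        intro i
        obtain ⟨j, hj⟩ := h i
        exact ih i hj (h' j)
      | mk μ k =>
        intro i
        obtain ⟨j, hj⟩ := h i
        obtain ⟨l, hl⟩ := h' j
        exact ⟨l, ih i hj hl⟩

theorem le_congr {x x' y y' : PreUSet.{u, v} Q} (hx : Equiv x x') (hy : Equiv y y') :
    Le x y ↔ Le x' y' :=
  ⟨fun h => ((Le.of_equiv hx.symm).trans h).trans (Le.of_equiv hy),
    fun h => ((Le.of_equiv hx).trans h).trans (Le.of_equiv hy.symm)⟩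

end Le

end PreUSet

/-- The class `V(Q)` of all sets over the urelements `Q`, urelements included. -/
def USet (Q : Type u) : Type (max u (v + 1)) :=
  Quotient (PreUSet.setoid.{u, v} Q)

namespace USet

variable {Q : Type u}

/-- The urelement `q`. -/
def atom (q : Q) : USet.{u, v} Q :=
  Quotient.mk _ (PreUSet.atom q)

/-- Being a urelement. -/
def IsAtom (x : USet.{u, v} Q) : Prop :=
  ∃ q, x = atom q

instance : Membership (USet.{u, v} Q) (USet.{u, v} Q) where
  mem y x := Quotient.liftOn₂ x y PreUSet.Mem
    fun _ _ _ _ hx hy => propext (PreUSet.mem_congr hx hy)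

/-- The rank of a set; irrelevant at urelements. -/
noncomputable def rank (x : USet.{u, v} Q) : Ordinal.{v} :=
  Quotient.liftOn x PreUSet.rank fun _ _ h => PreUSet.rank_congr h

theorem isAtom_mk {x : PreUSet.{u, v} Q} :
    IsAtom (Quotient.mk _ x : USet.{u, v} Q) ↔ PreUSet.IsAtom x := by
  constructor
  · rintro ⟨q, h⟩
    exact (PreUSet.isAtom_congr (Quotient.exact h)).2 trivial
  · cases x with
    | atom q => exact fun _ => ⟨q, rfl⟩
    | mk ι f => exact False.elim

/-- Urelements have no elements. -/
theorem not_mem_atom (x : USet.{u, v} Q) (q : Q) : ¬ x ∈ atom.{u, v} q := by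
  induction x using Quotient.inductionOn
  exact id

/-- The defining property of the rank. -/
theorem rank_le_iff {x : USet.{u, v} Q} (hx : ¬ IsAtom x) {α : Ordinal.{v}} :
    rank x ≤ α ↔ ∀ y ∈ x, ¬ IsAtom y → rank y < α := by
  induction x using Quotient.inductionOn with
  | h x =>
    cases x with
    | atom q => exact absurd ⟨q, rfl⟩ hx
    | mk ι f =>
      refine PreUSet.rank_mk_le_iff.trans ⟨fun H y => ?_, fun H i hi => ?_⟩
      · induction y using Quotient.inductionOn with
        | h y =>
          rintro ⟨i, hi⟩ hy
          have := H i fun hc => hy (isAtom_mk.2 ((PreUSet.isAtom_congr hi).2 hc))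
          rwa [← PreUSet.rank_congr hi] at this
      · exact H (Quotient.mk _ (f i)) ⟨i, PreUSet.Equiv.refl _⟩ fun hc => hi (isAtom_mk.1 hc)

/-- Two sets (not urelements) with the same elements are equal. -/
theorem ext {x y : USet.{u, v} Q} (hx : ¬ IsAtom x) (hy : ¬ IsAtom y)
    (h : ∀ z, z ∈ x ↔ z ∈ y) : x = y := by
  induction x using Quotient.inductionOn with
  | h x =>
    induction y using Quotient.inductionOn with
    | h y =>
      cases x with
      | atom q => exact absurd ⟨q, rfl⟩ hx
      | mk ι f =>
        cases y with
        | atom q => exact absurd ⟨q, rfl⟩ hy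
        | mk κ g =>
          refine Quotient.sound ⟨fun i => ?_, fun j => ?_⟩
          · exact (h (Quotient.mk _ (f i))).1 ⟨i, PreUSet.Equiv.refl _⟩
          · obtain ⟨i, hi⟩ := (h (Quotient.mk _ (g j))).2 ⟨j, PreUSet.Equiv.refl _⟩
            exact ⟨i, hi.symm⟩

section Le

variable [Preorder Q]

/-- The quasi-order `≲*` on `V(Q)`. -/
instance : Preorder (USet.{u, v} Q) where
  le x y := Quotient.liftOn₂ x y PreUSet.Le
    fun _ _ _ _ hx hy => propext (PreUSet.le_congr hx hy)
  le_refl x := by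
    induction x using Quotient.inductionOn
    exact PreUSet.Le.of_equiv (PreUSet.Equiv.refl _)
  le_trans x y z := by
    induction x using Quotient.inductionOn
    induction y using Quotient.inductionOn
    induction z using Quotient.inductionOn
    exact PreUSet.Le.trans

theorem atom_le_atom {p q : Q} : atom.{u, v} p ≤ atom.{u, v} q ↔ p ≤ q :=
  Iff.rfl

/-- For `x` not a urelement, `x ≲* q` means `x ≲* {q}`. -/
theorem le_atom_iff {x : USet.{u, v} Q} (hx : ¬ IsAtom x) {q : Q} :
    x ≤ atom q ↔ ∀ x' ∈ x, x' ≤ atom q := by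
  induction x using Quotient.inductionOn with
  | h x =>
    cases x with
    | atom q => exact absurd ⟨q, rfl⟩ hx
    | mk ι f =>
      constructor
      · intro H y
        induction y using Quotient.inductionOn with
        | h y =>
          rintro ⟨i, hi⟩
          exact (PreUSet.Le.of_equiv hi).trans (H i)
      · exact fun H i => H (Quotient.mk _ (f i)) ⟨i, PreUSet.Equiv.refl _⟩

/-- For `y` not a urelement, `p ≲* y` means `{p} ≲* y`. -/
theorem atom_le_iff {p : Q} {y : USet.{u, v} Q} (hy : ¬ IsAtom y) :
    atom p ≤ y ↔ ∃ y' ∈ y, atom p ≤ y' := by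
  induction y using Quotient.inductionOn with
  | h y =>
    cases y with
    | atom q => exact absurd ⟨q, rfl⟩ hy
    | mk κ g =>
      constructor
      · rintro ⟨j, hj⟩
        exact ⟨Quotient.mk _ (g j), ⟨j, PreUSet.Equiv.refl _⟩, hj⟩
      · rintro ⟨y', h, h'⟩
        induction y' using Quotient.inductionOn with
        | h y' =>
          obtain ⟨j, hj⟩ := h
          exact ⟨j, PreUSet.AtomLe.trans h' (PreUSet.Le.of_equiv hj)⟩

theorem le_iff {x y : USet.{u, v} Q} (hx : ¬ IsAtom x) (hy : ¬ IsAtom y) :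
    x ≤ y ↔ ∀ x' ∈ x, ∃ y' ∈ y, x' ≤ y' := by
  induction x using Quotient.inductionOn with
  | h x =>
    induction y using Quotient.inductionOn with
    | h y =>
      cases x with
      | atom q => exact absurd ⟨q, rfl⟩ hx
      | mk ι f =>
        cases y with
        | atom q => exact absurd ⟨q, rfl⟩ hy
        | mk κ g =>
          constructor
          · intro H x'
            induction x' using Quotient.inductionOn with
            | h x' =>
              rintro ⟨i, hi⟩
              obtain ⟨j, hj⟩ := H i
              exact ⟨Quotient.mk _ (g j), ⟨j, PreUSet.Equiv.refl _⟩,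
                (PreUSet.Le.of_equiv hi).trans hj⟩
          · intro H i
            obtain ⟨y', h, h'⟩ := H (Quotient.mk _ (f i)) ⟨i, PreUSet.Equiv.refl _⟩
            induction y' using Quotient.inductionOn with
            | h y' =>
              obtain ⟨j, hj⟩ := h
              exact ⟨j, PreUSet.Le.trans h' (PreUSet.Le.of_equiv hj)⟩

end Le

end USet

/-! ### Iterated ideals -/

/-- The class of all `x` that are urelements or have a urelement in their transitive closure. -/
def VDot (Q : Type u) : Set (USet.{u, v} Q) :=
  {x | ∃ q : Q, Relation.ReflTransGen (fun y z : USet.{u, v} Q => y ∈ z) (USet.atom q) x}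

/-- The urelements, and the members of `VDot Q` of rank less than `α`. -/
def VDotLT (Q : Type u) (α : Ordinal.{v}) : Set (USet.{u, v} Q) :=
  {x | x ∈ VDot Q ∧ (x.IsAtom ∨ x.rank < α)}

/-- The hereditarily upward-directed members of `VDotLT Q α`. -/
def IDot (Q : Type u) [Preorder Q] (α : Ordinal.{v}) : Set (USet.{u, v} Q) :=
  {x | x.IsAtom} ∪
    {x | x ∈ VDotLT Q α ∧ (∀ x' ∈ x, ∃ β, ∃ _ : β < α, x' ∈ IDot Q β) ∧
      ∀ y ∈ x, ∀ z ∈ x, ∃ w ∈ x, y ≤ w ∧ z ≤ w}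
termination_by α

/-! ### Fronts, arrays and better quasi-orders -/

/-- The finite set `σ` is an initial segment of `X` (written `σ ⊑ X`). -/
def IsInit (σ : Finset ℕ) (X : Set ℕ) : Prop :=
  (σ : Set ℕ) ⊆ X ∧ ∀ n ∈ X, ∀ m ∈ σ, n < m → n ∈ σ

/-- The union of the members of `F`. -/
def base (F : Set (Finset ℕ)) : Set ℕ :=
  ⋃ σ ∈ F, (σ : Set ℕ)

/-- The tree of proper initial segments of members of `F`. -/
def tree (F : Set (Finset ℕ)) : Set (Finset ℕ) :=
  {σ | (σ : Set ℕ) ⊆ base F ∧ ∃ τ ∈ F, IsInit σ τ ∧ σ ≠ τ}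

/-- A front together with a rank function on its tree. -/
structure Front where
  carrier : Set (Finset ℕ)
  infinite : carrier.Infinite
  antichain : ∀ σ ∈ carrier, ∀ τ ∈ carrier, IsInit σ τ → σ = τ
  exists_init : ∀ X : Set ℕ, X.Infinite → X ⊆ base carrier → ∃ σ ∈ carrier, IsInit σ X
  rk : tree carrier → Ordinal.{v}
  rk_lt : ∀ σ τ : tree carrier, IsInit σ.1 τ.1 → σ ≠ τ → rk τ < rk σ

theorem Front.empty_mem_tree (F : Front.{v}) : ∅ ∈ tree F.carrier := by
  obtain ⟨τ, hτ, h⟩ := F.infinite.exists_notMem_finset {∅}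
  exact ⟨by simp, τ, hτ, by simp [IsInit], by simpa [eq_comm] using h⟩

/-- The rank of a front: the value of its rank function at `∅`. -/
def Front.rank (F : Front.{v}) : Ordinal.{v} :=
  F.rk ⟨∅, F.empty_mem_tree⟩

/-- The relation `σ ◁ τ` on non-empty finite sets of naturals. -/
def Triangle (σ τ : Finset ℕ) : Prop :=
  ∃ (hσ : σ.Nonempty) (hτ : τ.Nonempty), σ.min' hσ < τ.min' hτ ∧
    (IsInit (σ.erase (σ.min' hσ)) τ ∨ IsInit τ ↑(σ.erase (σ.min' hσ)))

/-- The array `g` is bad. -/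
def IsBad {Q : Type u} [Preorder Q] (F : Front.{v}) (g : F.carrier → Q) : Prop :=
  ∀ σ τ : F.carrier, Triangle σ.1 τ.1 → ¬ g σ ≤ g τ

/-- `Q` is an `α`-well quasi-order. -/
def IsAlphaWqo (Q : Type u) [Preorder Q] (α : Ordinal.{v}) : Prop :=
  WellFoundedLT Q ∧ ∀ F : Front.{v}, F.rank < α → ¬ ∃ g : F.carrier → Q, IsBad F g

/-- `Q` is a better quasi-order: an `α`-well quasi-order for every `α`. Every front
has a rank function into the countable ordinals, so the choice of `v` is immaterial. -/
def IsBqo (Q : Type u) [Preorder Q] : Prop :=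
  ∀ α : Ordinal.{v}, IsAlphaWqo Q α

end IterIdeal

namespace IterIdeal

/-! ### Families as sets, and a uniform clause for `≲*` -/

namespace USet

variable {Q : Type u}

/-! Both directions of the equivalence translate between sequences of iterated ideals and arrays,
and both rest on `le_iff_isComponent`, which treats a urelement as its own only component and so
replaces the four clauses of `≲*` by one.

From a bad sequence to a bad array: if `x ≰ y`, some component of `x` lies below no component of
`y`. Iterating this choice along `f 0 < f 1 < ...`, and always comparing with the descent along the
shifted sequence `f 1 < f 2 < ...`, gives values that never lie below those of the shift
(`descend_not_le`). Ranks drop until a urelement is reached. The finite sets at which this first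
happens form a front, ranked by the sets passed on the way, and the urelements reached form a bad
array (`exists_isBad_of_badSeq`).

From an array to a good pair: a non-principal ultrafilter on the base of the front extends the array
to the inner nodes. The value at an inner node consists of those successor values that lie below
almost all the others. Directedness is immediate from the filter, and the wqo hypothesis makes
almost every successor value an element (`limitSet_mem_IDot`). At the root this gives a comparison
between the values at `{a}` and `{b}` for some `a < b`. Following it down through elements, with
later numbers chosen by the ultrafilter, ends at two leaves `σ ◁ τ` with `g σ ≤ g τ`
(`exists_le_of_limitSet_le`), so the array is not bad. -/

theorem isAtom_atom (q : Q) : IsAtom (atom.{u, v} q) := ⟨q, rfl⟩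

/-- The set with the elements `f i`. -/
noncomputable def ofFamily {ι : Type v} (f : ι → USet.{u, v} Q) : USet.{u, v} Q :=
  Quotient.mk _ (PreUSet.mk ι fun i => Quotient.out (f i))

theorem not_isAtom_ofFamily {ι : Type v} (f : ι → USet.{u, v} Q) : ¬ IsAtom (ofFamily f) :=
  fun h => isAtom_mk.1 h

theorem mem_ofFamily {ι : Type v} {f : ι → USet.{u, v} Q} {x : USet.{u, v} Q} :
    x ∈ ofFamily f ↔ ∃ i, x = f i := by
  induction x using Quotient.inductionOn with
  | h x =>
    refine exists_congr fun i => ?_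
    constructor
    · exact fun h => (Quotient.sound h).trans (Quotient.out_eq _)
    · exact fun h => Quotient.exact (h.trans (Quotient.out_eq _).symm)

theorem rank_lt_of_mem {x y : USet.{u, v} Q} (h : x ∈ y) (hx : ¬ IsAtom x) : rank x < rank y := by
  refine (rank_le_iff ?_).1 le_rfl x h hx
  rintro ⟨q, rfl⟩
  exact not_mem_atom _ _ h

/-- The components of a set are its elements; a urelement is its own only component. -/
def IsComponent (y x : USet.{u, v} Q) : Prop :=
  x.IsAtom ∧ y = x ∨ y ∈ x

theorem IsComponent.eq_of_isAtom {x y : USet.{u, v} Q} (h : IsComponent y x) (hx : IsAtom x) :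
    y = x := by
  rcases h with h | h
  · exact h.2
  · obtain ⟨q, rfl⟩ := hx
    exact absurd h (not_mem_atom _ _)

theorem IsComponent.mem {x y : USet.{u, v} Q} (h : IsComponent y x) (hx : ¬ IsAtom x) : y ∈ x :=
  h.resolve_left fun h => hx h.1

theorem IsAtom.isComponent {x : USet.{u, v} Q} (hx : IsAtom x) : IsComponent x x :=
  Or.inl ⟨hx, rfl⟩

theorem le_iff_isComponent [Preorder Q] {x y : USet.{u, v} Q} :
    x ≤ y ↔ ∀ x', IsComponent x' x → ∃ y', IsComponent y' y ∧ x' ≤ y' := by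
  by_cases hx : IsAtom x <;> by_cases hy : IsAtom y
  · constructor
    · intro h x' hx'
      exact ⟨y, hy.isComponent, (hx'.eq_of_isAtom hx).symm ▸ h⟩
    · intro h
      obtain ⟨y', hy', h'⟩ := h x hx.isComponent
      exact hy'.eq_of_isAtom hy ▸ h'
  · obtain ⟨p, rfl⟩ := hx
    rw [atom_le_iff hy]
    constructor
    · rintro ⟨y', hy', h⟩ x' hx'
      exact ⟨y', Or.inr hy', (hx'.eq_of_isAtom (isAtom_atom p)).symm ▸ h⟩
    · intro h
      obtain ⟨y', hy', h'⟩ := h _ (isAtom_atom p).isComponent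
      exact ⟨y', hy'.mem hy, h'⟩
  · obtain ⟨q, rfl⟩ := hy
    rw [le_atom_iff hx]
    constructor
    · intro h x' hx'
      exact ⟨_, (isAtom_atom q).isComponent, h x' (hx'.mem hx)⟩
    · intro h x' hx'
      obtain ⟨y', hy', h'⟩ := h x' (Or.inr hx')
      exact hy'.eq_of_isAtom (isAtom_atom q) ▸ h'
  · rw [le_iff hx hy]
    constructor
    · intro h x' hx'
      obtain ⟨y', hy', h'⟩ := h x' (hx'.mem hx)
      exact ⟨y', Or.inr hy', h'⟩
    · intro h x' hx'
      obtain ⟨y', hy', h'⟩ := h x' (Or.inr hx')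
      exact ⟨y', hy'.mem hy, h'⟩

end USet

open USet

/-! ### Basic properties of iterated ideals -/

section IDot

variable {Q : Type u} [Preorder Q]

theorem mem_IDot {α : Ordinal.{v}} {x : USet.{u, v} Q} :
    x ∈ IDot Q α ↔ x.IsAtom ∨ x ∈ VDotLT Q α ∧ (∀ x' ∈ x, ∃ β < α, x' ∈ IDot Q β) ∧
      ∀ y ∈ x, ∀ z ∈ x, ∃ w ∈ x, y ≤ w ∧ z ≤ w := by
  rw [IDot]
  simp only [Set.mem_union, Set.mem_ofPred_eq, exists_prop]

theorem atom_mem_IDot (α : Ordinal.{v}) (q : Q) : atom q ∈ IDot Q α :=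
  mem_IDot.2 (Or.inl (isAtom_atom q))

theorem IDot_mono {α β : Ordinal.{v}} (h : α ≤ β) : IDot Q α ⊆ IDot Q β := by
  intro x hx
  rcases mem_IDot.1 hx with hx | ⟨h₁, h₂, h₃⟩
  · exact mem_IDot.2 (Or.inl hx)
  · refine mem_IDot.2 (Or.inr ⟨⟨h₁.1, h₁.2.imp_right fun h' => h'.trans_le h⟩, ?_, h₃⟩)
    intro x' hx'
    obtain ⟨γ, hγ, hm⟩ := h₂ x' hx'
    exact ⟨γ, hγ.trans_le h, hm⟩

theorem rank_lt_of_mem_IDot {α : Ordinal.{v}} {x : USet.{u, v} Q} (hx : x ∈ IDot Q α)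
    (h : ¬ x.IsAtom) : x.rank < α := by
  rcases mem_IDot.1 hx with hx | ⟨h₁, -⟩
  · exact absurd hx h
  · exact h₁.2.resolve_left h

theorem mem_VDot_of_mem_IDot {α : Ordinal.{v}} {x : USet.{u, v} Q} (hx : x ∈ IDot Q α) :
    x ∈ VDot Q := by
  rcases mem_IDot.1 hx with ⟨q, rfl⟩ | ⟨h₁, -⟩
  · exact ⟨q, .refl⟩
  · exact h₁.1

end IDot

/-! ### Initial segments -/

theorem IsInit.trans {σ τ : Finset ℕ} {X : Set ℕ} (h : IsInit σ τ) (h' : IsInit τ X) :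
    IsInit σ X :=
  ⟨h.1.trans h'.1, fun n hn m hm hnm => h.2 n (h'.2 n hn m (h.1 hm) hnm) m hm hnm⟩

theorem IsInit.refl (σ : Finset ℕ) : IsInit σ σ := ⟨subset_rfl, fun _ hn _ _ _ => hn⟩

theorem isInit_empty (X : Set ℕ) : IsInit ∅ X := by simp [IsInit]

theorem IsInit.subset {σ τ : Finset ℕ} (h : IsInit σ τ) : σ ⊆ τ := by exact_mod_cast h.1

theorem IsInit.of_subset {σ τ : Finset ℕ} {X : Set ℕ} (h : IsInit σ X) (h' : IsInit τ X)
    (hs : σ ⊆ τ) : IsInit σ τ :=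
  ⟨by exact_mod_cast hs, fun n hn m hm hnm => h.2 n (h'.1 hn) m hm hnm⟩

theorem IsInit.total {σ τ : Finset ℕ} {X : Set ℕ} (h : IsInit σ X) (h' : IsInit τ X) :
    IsInit σ τ ∨ IsInit τ σ := by
  by_cases hs : σ ⊆ τ
  · exact Or.inl (h.of_subset h' hs)
  · refine Or.inr (h'.of_subset h fun n hn => ?_)
    obtain ⟨m, hm, hmτ⟩ := Finset.not_subset.1 hs
    rcases lt_trichotomy n m with hnm | rfl | hnm
    · exact h.2 n (h'.1 hn) m hm hnm
    · exact hm
    · exact absurd (h'.2 m (h.1 hm) n hn hnm) hmτ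

theorem IsInit.eq_of_card_le {σ τ : Finset ℕ} (h : IsInit σ τ) (hc : τ.card ≤ σ.card) : σ = τ :=
  Finset.eq_of_subset_of_card_le h.subset hc

theorem isInit_insert {σ : Finset ℕ} {n : ℕ} (h : ∀ m ∈ σ, m < n) :
    IsInit σ ↑(insert n σ : Finset ℕ) := by
  refine ⟨by simp, fun k hk m hm hkm => ?_⟩
  rcases Finset.mem_insert.1 (Finset.mem_coe.1 hk) with rfl | hk
  · exact absurd (h m hm) (by omega)
  · exact hk

/-- The set of the first `k` values of `f`. -/
def segment (f : ℕ → ℕ) (k : ℕ) : Finset ℕ := (Finset.range k).image f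

theorem mem_segment {f : ℕ → ℕ} {k n : ℕ} : n ∈ segment f k ↔ ∃ i < k, f i = n := by
  simp [segment]

theorem card_segment {f : ℕ → ℕ} (hf : StrictMono f) (k : ℕ) : (segment f k).card = k := by
  rw [segment, Finset.card_image_of_injective _ hf.injective, Finset.card_range]

theorem isInit_segment_range {f : ℕ → ℕ} (hf : StrictMono f) (k : ℕ) :
    IsInit (segment f k) (Set.range f) := by
  constructor
  · intro n hn
    obtain ⟨i, -, rfl⟩ := mem_segment.1 hn
    exact ⟨i, rfl⟩
  · rintro _ ⟨j, rfl⟩ m hm hlt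
    obtain ⟨i, hi, rfl⟩ := mem_segment.1 hm
    exact mem_segment.2 ⟨j, (hf.lt_iff_lt.1 hlt).trans hi, rfl⟩

theorem segment_congr {f g : ℕ → ℕ} {k : ℕ} (h : ∀ i < k, f i = g i) :
    segment f k = segment g k :=
  Finset.image_congr fun i hi => h i (by simpa using hi)

theorem IsInit.eq_segment {σ : Finset ℕ} {f : ℕ → ℕ} (hf : StrictMono f)
    (h : IsInit σ (Set.range f)) : σ = segment f σ.card := by
  rcases h.total (isInit_segment_range hf σ.card) with h' | h'
  · exact h'.eq_of_card_le (card_segment hf _).le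
  · exact (h'.eq_of_card_le (card_segment hf _).ge).symm

theorem IsInit.eq_of_lt {f g : ℕ → ℕ} (hf : StrictMono f) (hg : StrictMono g) {k : ℕ}
    (h : IsInit (segment f k) (Set.range g)) : ∀ i < k, f i = g i := by
  intro i
  induction i using Nat.strong_induction_on with
  | h i ih =>
    intro hi
    obtain ⟨j, hj⟩ := h.1 (mem_segment.2 ⟨i, hi, rfl⟩ : f i ∈ segment f k)
    have hij : i ≤ j := by
      by_contra! hlt
      have := ih j hlt (hlt.trans hi)
      exact hlt.ne (hf.injective (this.trans hj))
    -- If `g i < f i`, initiality puts `g i` among the earlier values `f l = g l` with `l < i`,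
    -- against injectivity of `g`.
    by_contra hne
    have hlt : g i < f i := lt_of_le_of_ne (hj ▸ hg.monotone hij) (Ne.symm hne)
    obtain ⟨l, hl, hfl⟩ :=
      mem_segment.1 (h.2 (g i) ⟨i, rfl⟩ (f i) (mem_segment.2 ⟨i, hi, rfl⟩) hlt)
    have hli : l < i := hf.lt_iff_lt.1 (hfl ▸ hlt)
    exact hli.ne (hg.injective ((ih l hli hl).symm.trans hfl))

theorem isInit_segment_segment {f g : ℕ → ℕ} (hf : StrictMono f) (hg : StrictMono g) {k l : ℕ}
    (h : IsInit (segment f k) ↑(segment g l)) : k ≤ l ∧ ∀ i < k, f i = g i := by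
  refine ⟨?_, (h.trans (isInit_segment_range hg l)).eq_of_lt hf hg⟩
  have := Finset.card_le_card h.subset
  rwa [card_segment hf, card_segment hg] at this

theorem segment_eq_iff {f g : ℕ → ℕ} (hf : StrictMono f) (hg : StrictMono g) {k l : ℕ}
    (h : segment f k = segment g l) : k = l ∧ ∀ i < k, f i = g i := by
  have h₁ := isInit_segment_segment (k := k) (l := l) hf hg (h ▸ IsInit.refl _)
  have h₂ := isInit_segment_segment (k := l) (l := k) hg hf (h ▸ IsInit.refl _)
  exact ⟨le_antisymm h₁.1 h₂.1, h₁.2⟩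

theorem min'_segment_succ {f : ℕ → ℕ} (hf : StrictMono f) (k : ℕ)
    (h : (segment f (k + 1)).Nonempty) : (segment f (k + 1)).min' h = f 0 := by
  refine le_antisymm (Finset.min'_le _ _ (mem_segment.2 ⟨0, k.succ_pos, rfl⟩)) ?_
  refine Finset.le_min' _ _ _ fun n hn => ?_
  obtain ⟨i, -, rfl⟩ := mem_segment.1 hn
  exact hf.monotone (Nat.zero_le i)

theorem segment_erase {f : ℕ → ℕ} (hf : StrictMono f) (k : ℕ) :
    (segment f (k + 1)).erase (f 0) = segment (fun i => f (i + 1)) k := by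
  ext n
  simp only [Finset.mem_erase, mem_segment]
  constructor
  · rintro ⟨hn, i, hi, rfl⟩
    cases i with
    | zero => exact absurd rfl hn
    | succ i => exact ⟨i, by omega, rfl⟩
  · rintro ⟨i, hi, rfl⟩
    exact ⟨(hf i.succ_pos).ne', i + 1, by omega, rfl⟩

theorem exists_strictMono_range {X : Set ℕ} (hX : X.Infinite) :
    ∃ f : ℕ → ℕ, StrictMono f ∧ Set.range f = X :=
  ⟨Nat.nth (· ∈ X), Nat.nth_strictMono hX, Nat.range_nth_of_infinite hX⟩

/-! ### From bad sequences to bad arrays -/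

section Descent

variable {Q : Type u} [Preorder Q]

open Classical in
/-- If `x ≰ y`, a component of `x` that is not below any component of `y`. -/
noncomputable def witness (x y : USet.{u, v} Q) : USet.{u, v} Q :=
  if h : ∃ x', IsComponent x' x ∧ ∀ y', IsComponent y' y → ¬ x' ≤ y' then h.choose else x

theorem witness_spec {x y : USet.{u, v} Q} (h : ¬ x ≤ y) :
    IsComponent (witness x y) x ∧ ∀ y', IsComponent y' y → ¬ witness x y ≤ y' := by
  have h' : ∃ x', IsComponent x' x ∧ ∀ y', IsComponent y' y → ¬ x' ≤ y' := by
    rw [le_iff_isComponent] at h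
    push Not at h
    exact h
  rw [witness, dif_pos h']
  exact h'.choose_spec

/-- Starting from the sequence `x`, descend along `f` to components witnessing failures of
comparability. -/
noncomputable def descend (x : ℕ → USet.{u, v} Q) (f : ℕ → ℕ) : ℕ → USet.{u, v} Q
  | 0 => x (f 0)
  | k + 1 => witness (descend x f k) (descend x (fun i => f (i + 1)) k)

/-- Stage `k` along `f` and stage `k` along its shift together read one value more than stage `k`.
Hence the descent is a function of finite sets of size `k + 1`. -/
theorem descend_congr (x : ℕ → USet.{u, v} Q) {f g : ℕ → ℕ} {k : ℕ}
    (h : ∀ i < k + 1, f i = g i) : descend x f k = descend x g k := by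
  induction k generalizing f g with
  | zero => rw [descend, descend, h 0 (by omega)]
  | succ k ih =>
    rw [descend, descend, ih fun i hi => h i (by omega), ih fun i hi => h (i + 1) (by omega)]

variable {x : ℕ → USet.{u, v} Q} {f : ℕ → ℕ}

/-- The witness along `f` avoids every component of the previous value along the shift, and the next
value along the shift is one of these components. -/
theorem descend_not_le (hx : ∀ m n, m < n → ¬ x m ≤ x n) (hf : StrictMono f) (k : ℕ) :
    ¬ descend x f k ≤ descend x (fun i => f (i + 1)) k := by
  induction k generalizing f with
  | zero => exact hx _ _ (hf Nat.zero_lt_one)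
  | succ k ih =>
    have hf' : StrictMono fun i => f (i + 1) := fun i j hij => hf (Nat.succ_lt_succ hij)
    exact (witness_spec (ih hf)).2 _ (witness_spec (ih hf')).1

theorem isComponent_descend_succ (hx : ∀ m n, m < n → ¬ x m ≤ x n) (hf : StrictMono f) (k : ℕ) :
    IsComponent (descend x f (k + 1)) (descend x f k) :=
  (witness_spec (descend_not_le hx hf k)).1

theorem descend_eq_of_isAtom (hx : ∀ m n, m < n → ¬ x m ≤ x n) (hf : StrictMono f) {k l : ℕ}
    (hkl : k ≤ l) (h : (descend x f k).IsAtom) : descend x f l = descend x f k := by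
  induction l, hkl using Nat.le_induction with
  | base => rfl
  | succ l _ ih => exact ((isComponent_descend_succ hx hf l).eq_of_isAtom (ih ▸ h)).trans ih

theorem not_isAtom_descend_of_le (hx : ∀ m n, m < n → ¬ x m ≤ x n) (hf : StrictMono f) {k l : ℕ}
    (hkl : k ≤ l) (h : ¬ (descend x f l).IsAtom) : ¬ (descend x f k).IsAtom :=
  fun hk => h (descend_eq_of_isAtom hx hf hkl hk ▸ hk)

theorem rank_descend_lt (hx : ∀ m n, m < n → ¬ x m ≤ x n) (hf : StrictMono f) {k l : ℕ}
    (hkl : k < l) (h : ¬ (descend x f l).IsAtom) :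
    (descend x f l).rank < (descend x f k).rank := by
  induction l, hkl using Nat.le_induction with
  | base =>
    have hk := not_isAtom_descend_of_le hx hf k.le_succ h
    exact rank_lt_of_mem ((isComponent_descend_succ hx hf k).mem hk) h
  | succ l _ ih =>
    have hl := not_isAtom_descend_of_le hx hf l.le_succ h
    exact (rank_lt_of_mem ((isComponent_descend_succ hx hf l).mem hl) h).trans (ih hl)

theorem exists_isAtom_descend (hx : ∀ m n, m < n → ¬ x m ≤ x n) (hf : StrictMono f) :
    ∃ k, (descend x f k).IsAtom ∧ ∀ j < k, ¬ (descend x f j).IsAtom := by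
  classical
  have h : ∃ k, (descend x f k).IsAtom := by
    by_contra! h
    -- A descent through sets only would be an infinite descending sequence of ranks.
    exact (RelEmbedding.natGT (r := (· < ·)) (fun k => (descend x f k).rank)
      fun k => rank_descend_lt hx hf k.lt_succ_self (h _)).not_wellFounded wellFounded_lt
  exact ⟨Nat.find h, Nat.find_spec h, fun j hj => Nat.find_min h hj⟩

/-- The finite sets along which the descent from `x` reaches a urelement for the first time. -/
def descentFront (x : ℕ → USet.{u, v} Q) : Set (Finset ℕ) :=
  {σ | ∃ f k, StrictMono f ∧ σ = segment f (k + 1) ∧ (descend x f k).IsAtom ∧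
    ∀ j < k, ¬ (descend x f j).IsAtom}

theorem exists_segment_mem_descentFront (hx : ∀ m n, m < n → ¬ x m ≤ x n) (hf : StrictMono f) :
    ∃ k, segment f (k + 1) ∈ descentFront x := by
  obtain ⟨k, hk, hk'⟩ := exists_isAtom_descend hx hf
  exact ⟨k, f, k, hf, rfl, hk, hk'⟩

open Classical in
/-- The value of the descent from `x` along a non-empty finite set. -/
noncomputable def descentValue (x : ℕ → USet.{u, v} Q) (σ : Finset ℕ) : USet.{u, v} Q :=
  if h : ∃ f k, StrictMono f ∧ σ = segment f (k + 1) then descend x h.choose h.choose_spec.choose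
  else x 0

/-- The choice of the sequence through a finite set is immaterial by `descend_congr`. -/
theorem descentValue_segment (x : ℕ → USet.{u, v} Q) (hf : StrictMono f) (k : ℕ) :
    descentValue x (segment f (k + 1)) = descend x f k := by
  have h : ∃ g l, StrictMono g ∧ segment f (k + 1) = segment g (l + 1) := ⟨f, k, hf, rfl⟩
  rw [descentValue, dif_pos h]
  obtain ⟨hg, he⟩ := h.choose_spec.choose_spec
  obtain ⟨hk, hi⟩ := segment_eq_iff hf hg he
  rw [← Nat.succ_injective hk]
  exact (descend_congr x hi).symm

theorem exists_of_mem_tree_descentFront {σ : Finset ℕ} (hσ : σ ∈ tree (descentFront x)) :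
    ∃ f k, StrictMono f ∧ σ = segment f k ∧ ∀ j < k, ¬ (descend x f j).IsAtom := by
  obtain ⟨-, _, ⟨f, k, hf, rfl, -, hk⟩, hi, hne⟩ := hσ
  have he := (hi.trans (isInit_segment_range hf _)).eq_segment hf
  refine ⟨f, σ.card, hf, he, fun j hj => hk j ?_⟩
  have hlt := Finset.card_lt_card (hi.subset.ssubset_of_ne hne)
  rw [card_segment hf] at hlt
  omega

open Classical in
/-- The front of the descent from a bad sequence in `IDot Q α`. -/
noncomputable def Front.ofBadSeq {α : Ordinal.{v}} (x : ℕ → USet.{u, v} Q)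
    (hx : ∀ m n, m < n → ¬ x m ≤ x n) (hα : ∀ n, x n ∈ IDot Q α) : Front.{v} where
  carrier := descentFront x
  infinite := by
    have hf : ∀ n : ℕ, StrictMono fun i => n + i := fun n i j hij => Nat.add_lt_add_left hij n
    choose k hk using fun n => exists_segment_mem_descentFront hx (hf n)
    refine Set.infinite_of_injective_forall_mem (f := fun n => segment (fun i => n + i) (k n + 1))
      (fun m n hmn => ?_) hk
    simpa using (segment_eq_iff (hf m) (hf n) hmn).2 0 (Nat.succ_pos _)
  antichain := by
    rintro _ ⟨f, k, hf, rfl, hk, hk'⟩ _ ⟨g, l, hg, rfl, hl, hl'⟩ h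
    obtain ⟨hkl, hi⟩ := isInit_segment_segment hf hg h
    have : k = l := by
      -- If `k < l`, the descent along `g` would already have met a urelement at stage `k`.
      by_contra hne
      exact hl' k (by omega) (descend_congr x hi ▸ hk)
    subst this
    exact segment_congr hi
  exists_init := by
    intro X hX _
    obtain ⟨f, hf, rfl⟩ := exists_strictMono_range hX
    obtain ⟨k, hk⟩ := exists_segment_mem_descentFront hx hf
    exact ⟨_, hk, isInit_segment_range hf _⟩
  rk σ := if σ.1 = ∅ then α else (descentValue x σ.1).rank
  rk_lt := by
    rintro ⟨σ, hσ⟩ ⟨τ, hτ⟩ h hne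
    obtain ⟨f, k, hf, rfl, hk⟩ := exists_of_mem_tree_descentFront hτ
    have he := (h.trans (isInit_segment_range hf _)).eq_segment hf
    dsimp only at h he ⊢
    have hlt : σ.card < k := by
      have := Finset.card_lt_card (h.subset.ssubset_of_ne fun hc => hne (Subtype.ext hc))
      rwa [card_segment hf] at this
    obtain ⟨l, rfl⟩ : ∃ l, k = l + 1 := ⟨k - 1, by omega⟩
    have hl : ¬ (descend x f l).IsAtom := hk l l.lt_succ_self
    have h0 : segment f (l + 1) ≠ ∅ :=
      Finset.nonempty_iff_ne_empty.1 ⟨_, mem_segment.2 ⟨0, l.succ_pos, rfl⟩⟩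
    rw [if_neg h0, descentValue_segment x hf]
    split_ifs with h1
    · rcases Nat.eq_zero_or_pos l with rfl | hpos
      · exact rank_lt_of_mem_IDot (hα _) hl
      · exact (rank_descend_lt hx hf hpos hl).trans
          (rank_lt_of_mem_IDot (hα _) (not_isAtom_descend_of_le hx hf (Nat.zero_le l) hl))
    · obtain ⟨j, hj⟩ : ∃ j, σ.card = j + 1 :=
        ⟨σ.card - 1, by have := Finset.card_ne_zero.2 (Finset.nonempty_iff_ne_empty.2 h1); omega⟩
      rw [he, hj, descentValue_segment x hf]
      exact rank_descend_lt hx hf (by omega) hl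

theorem exists_isBad_of_badSeq {α : Ordinal.{v}} (hx : ∀ m n, m < n → ¬ x m ≤ x n)
    (hα : ∀ n, x n ∈ IDot Q α) :
    ∃ (F : Front.{v}) (g : F.carrier → Q), F.rank ≤ α ∧ IsBad F g := by
  have hval : ∀ σ : (Front.ofBadSeq x hx hα).carrier, ∃ q, descentValue x σ.1 = atom q := by
    rintro ⟨_, f, k, hf, rfl, hk, -⟩
    rw [descentValue_segment x hf]
    exact hk
  choose g hg using hval
  refine ⟨Front.ofBadSeq x hx hα, g, ?_, ?_⟩
  · simp [Front.rank, Front.ofBadSeq]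
  · intro σ τ h hle
    rw [← atom_le_atom.{u, v}, ← hg, ← hg] at hle
    obtain ⟨_, f, k, hf, rfl, hk, _⟩ := σ
    obtain ⟨_, g, l, hg, rfl, hl, _⟩ := τ
    dsimp only at h hle
    rw [descentValue_segment x hf, descentValue_segment x hg] at hle
    obtain ⟨hσ, hτ, hlt, h⟩ := h
    simp only [min'_segment_succ hf, min'_segment_succ hg, segment_erase hf] at hlt h
    have hf' : StrictMono fun i => f (i + 1) := fun i j hij => hf (Nat.succ_lt_succ hij)
    -- The relation `σ ◁ τ` provides a single sequence `e` with `σ` initial in `e` and `τ` initial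
    -- in its shift.
    obtain ⟨e, he, hef, heg⟩ : ∃ e : ℕ → ℕ, StrictMono e ∧ (∀ i < k + 1, f i = e i) ∧
        ∀ i < l + 1, g i = e (i + 1) := by
      rcases h with h | h
      · obtain ⟨-, hi⟩ := isInit_segment_segment hf' hg h
        refine ⟨fun i => Nat.casesOn i (f 0) g, strictMono_nat_of_lt_succ ?_, ?_, fun _ _ => rfl⟩
        · rintro (_ | i)
          · exact hlt
          · exact hg i.lt_succ_self
        · rintro (_ | i) hik
          · rfl
          · exact hi i (by omega)
      · exact ⟨f, hf, fun _ _ => rfl, (isInit_segment_segment hg hf' h).2⟩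
    have he' : StrictMono fun i => e (i + 1) := fun i j hij => he (Nat.succ_lt_succ hij)
    rw [descend_congr x hef] at hk hle
    rw [descend_congr x heg] at hl hle
    -- A urelement, once reached, persists, so both descents can be prolonged to the common stage
    -- `max k l`.
    rw [← descend_eq_of_isAtom hx he (le_max_left k l) hk,
      ← descend_eq_of_isAtom hx he' (le_max_right k l) hl] at hle
    exact descend_not_le hx he _ hle

end Descent

/-! ### From bad arrays to bad sequences -/

section Ascent

open Filter

/-! ### Nodes, heights and an ultrafilter on the base -/

theorem mem_base {F : Set (Finset ℕ)} {σ : Finset ℕ} (hσ : σ ∈ F) {n : ℕ} (hn : n ∈ σ) :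
    n ∈ base F :=
  Set.mem_biUnion hσ hn

theorem Front.infinite_base (F : Front.{v}) : (base F.carrier).Infinite := by
  intro h
  refine F.infinite ((h.toFinset.powerset.finite_toSet).subset fun σ hσ => ?_)
  simp only [Finset.mem_coe, Finset.mem_powerset]
  exact fun n hn => h.mem_toFinset.2 (mem_base hσ hn)

theorem Front.notMem_tree (F : Front.{v}) {σ : Finset ℕ} (hσ : σ ∈ F.carrier) :
    σ ∉ tree F.carrier := by
  rintro ⟨-, τ, hτ, h, hne⟩
  exact hne (F.antichain σ hσ τ hτ h)

/-- Prolong `insert n σ` by all later elements of the base. The front has a member `τ` initial in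
the resulting set. By the antichain property `τ` cannot be initial in the inner node `σ`, so it
extends or equals `insert n σ`. -/
theorem Front.insert_mem (F : Front.{v}) {σ : Finset ℕ} (hσ : σ ∈ tree F.carrier) {n : ℕ}
    (hn : n ∈ base F.carrier) (h : ∀ m ∈ σ, m < n) :
    insert n σ ∈ tree F.carrier ∨ insert n σ ∈ F.carrier := by
  obtain ⟨hσb, τ', hτ', hστ', hne⟩ := hσ
  set X : Set ℕ := ↑(insert n σ) ∪ {m ∈ base F.carrier | n < m} with hX
  have hinit : IsInit (insert n σ) X := by
    refine ⟨Set.subset_union_left, fun k hk m hm hkm => ?_⟩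
    rcases hk with hk | ⟨-, hk⟩
    · exact hk
    · rcases Finset.mem_insert.1 hm with rfl | hm
      · omega
      · have := h m hm
        omega
  have hins : (↑(insert n σ : Finset ℕ) : Set ℕ) ⊆ base F.carrier := by
    rw [Finset.coe_insert]
    exact Set.insert_subset hn hσb
  have hXb : X ⊆ base F.carrier := Set.union_subset hins fun m hm => hm.1
  have hXi : X.Infinite := by
    refine Set.Infinite.mono Set.subset_union_right ?_
    refine (F.infinite_base.sdiff (Set.finite_Iic n)).mono fun m hm => ⟨hm.1, ?_⟩
    simpa using hm.2
  obtain ⟨τ, hτ, hτX⟩ := F.exists_init X hXi hXb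
  have hσi := isInit_insert h
  rcases hτX.total hinit with h' | h'
  · rcases h'.total hσi with h'' | h''
    · have : τ = τ' := F.antichain τ hτ τ' hτ' (h''.trans hστ')
      subst this
      exact absurd (hστ'.subset.antisymm h''.subset) hne
    · by_cases hnτ : n ∈ τ
      · right
        have : τ = insert n σ :=
          h'.subset.antisymm (Finset.insert_subset hnτ h''.subset)
        exact this ▸ hτ
      · have : τ = σ := by
          refine Finset.Subset.antisymm (fun m hm => ?_) h''.subset
          exact (Finset.mem_insert.1 (h'.subset hm)).resolve_left fun hc => hnτ (hc ▸ hm)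
        subst this
        exact absurd (F.antichain _ hτ τ' hτ' hστ') hne
  · by_cases he : insert n σ = τ
    · exact Or.inr (he ▸ hτ)
    · exact Or.inl ⟨hins, τ, hτ, h', he⟩

open Classical in
/-- The rank of a node, with the leaves at rank zero below all others. -/
noncomputable def Front.height (F : Front.{v}) (σ : Finset ℕ) : Ordinal.{v} :=
  if h : σ ∈ tree F.carrier then Order.succ (F.rk ⟨σ, h⟩) else 0

/-- The bound is the rank of `σ`, not its height, which is one larger. So the values at successors
stay within `IDot Q α` when the front has rank at most `α`, even at the root. -/
theorem Front.height_insert_le (F : Front.{v}) {σ : Finset ℕ} (hσ : σ ∈ tree F.carrier) {n : ℕ}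
    (h : ∀ m ∈ σ, m < n) : F.height (insert n σ) ≤ F.rk ⟨σ, hσ⟩ := by
  rw [height]
  split_ifs with h'
  · refine Order.succ_le_of_lt (F.rk_lt ⟨σ, hσ⟩ ⟨insert n σ, h'⟩ (isInit_insert h) fun hc => ?_)
    have hc : σ = insert n σ := Subtype.ext_iff.1 hc
    exact (h n (Finset.insert_eq_self.1 hc.symm)).false
  · exact zero_le

theorem Front.height_insert_lt (F : Front.{v}) {σ : Finset ℕ} (hσ : σ ∈ tree F.carrier) {n : ℕ}
    (h : ∀ m ∈ σ, m < n) : F.height (insert n σ) < F.height σ := by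
  rw [show F.height σ = _ from dif_pos hσ]
  exact (F.height_insert_le hσ h).trans_lt (Order.lt_succ _)

theorem Front.rk_le_rank (F : Front.{v}) {σ : Finset ℕ} (hσ : σ ∈ tree F.carrier) :
    F.rk ⟨σ, hσ⟩ ≤ F.rank := by
  by_cases h : σ = ∅
  · subst h
    exact le_rfl
  · exact (F.rk_lt ⟨∅, F.empty_mem_tree⟩ ⟨σ, hσ⟩ (isInit_empty _)
      fun hc => h (Subtype.ext_iff.1 hc).symm).le

/-- A non-principal ultrafilter on the base of the front. -/
noncomputable def Front.ultrafilter (F : Front.{v}) : Ultrafilter ℕ :=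
  haveI : (atTop ⊓ 𝓟 (base F.carrier)).NeBot := by
    rw [← Nat.cofinite_eq_atTop]
    exact F.infinite_base.cofinite_inf_principal_neBot
  Ultrafilter.of (atTop ⊓ 𝓟 (base F.carrier))

theorem Front.ultrafilter_le (F : Front.{v}) :
    (F.ultrafilter : Filter ℕ) ≤ atTop ⊓ 𝓟 (base F.carrier) :=
  haveI : (atTop ⊓ 𝓟 (base F.carrier)).NeBot := by
    rw [← Nat.cofinite_eq_atTop]
    exact F.infinite_base.cofinite_inf_principal_neBot
  Ultrafilter.of_le _

theorem Front.eventually_mem_base (F : Front.{v}) : ∀ᶠ n in F.ultrafilter, n ∈ base F.carrier :=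
  (F.ultrafilter_le.trans inf_le_right) (mem_principal_self _)

theorem Front.eventually_gt (F : Front.{v}) (σ : Finset ℕ) :
    ∀ᶠ n in F.ultrafilter, ∀ m ∈ σ, m < n := by
  refine (F.ultrafilter_le.trans inf_le_left) ?_
  filter_upwards [eventually_gt_atTop (σ.sup id)] with n hn m hm
  exact (Finset.le_sup (f := id) hm).trans_lt hn

/-- Otherwise almost every `n` has `x n ≰ x m` for almost all `m`. Finitely many such conditions can
be met at once, so a bad sequence can be chosen term by term. -/
theorem eventually_eventually_le_of_wellQuasiOrdered {β : Type*} [Preorder β] {s : Set β}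
    (hs : WellQuasiOrdered fun x y : s => x ≤ y) (U : Ultrafilter ℕ) {x : ℕ → β}
    (hx : ∀ᶠ n in U, x n ∈ s) : ∀ᶠ n in U, ∀ᶠ m in U, x n ≤ x m := by
  by_contra hc
  rw [← Ultrafilter.eventually_not] at hc
  simp only [← Ultrafilter.eventually_not] at hc
  obtain ⟨f, hf, hf'⟩ := exists_seq_of_forall_finset_exists
    (fun n => x n ∈ s ∧ ∀ᶠ m in U, ¬ x n ≤ x m) (fun n m => ¬ x n ≤ x m) (fun t ht => by
      have h := (eventually_all_finset t).2 fun n hn => (ht n hn).2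
      exact ((hx.and hc).and h).exists)
  obtain ⟨m, n, hmn, hle⟩ := hs fun i => ⟨x (f i), (hf i).1⟩
  exact hf' m n hmn hle

theorem Front.nonempty_codomain {Q : Type u} (F : Front.{v}) (g : F.carrier → Q) : Nonempty Q :=
  let ⟨σ, hσ⟩ := F.infinite.nonempty
  ⟨g ⟨σ, hσ⟩⟩

/-! ### Limits of an array along the ultrafilter -/

variable {Q : Type u} [Preorder Q] {F : Front.{v}}

open Classical in
/-- The array `g`, extended to the tree of the front: the value at an inner node is the ideal
generated by the values at the successors along the ultrafilter. -/
noncomputable def limitSet (g : F.carrier → Q) (σ : Finset ℕ) : USet.{u, v} Q :=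
  if hσ : σ ∈ tree F.carrier then
    -- The subtype records that `n` lies beyond `σ`, which makes the height drop in the recursive
    -- call.
    let y : {n : ℕ // ∀ m ∈ σ, m < n} → USet.{u, v} Q := fun n => limitSet g (insert n.1 σ)
    ofFamily fun i : ULift.{v} {n : {n : ℕ // ∀ m ∈ σ, m < n} // n.1 ∈ base F.carrier ∧
      ∀ᶠ m in F.ultrafilter, ∃ hm : ∀ k ∈ σ, k < m, y n ≤ y ⟨m, hm⟩} => y i.down.1
  else if h : σ ∈ F.carrier then atom (g ⟨σ, h⟩)
  -- A default off the tree and the front; being a urelement, it lies in every `IDot Q β`.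
  else atom (F.nonempty_codomain g).some
termination_by F.height σ
decreasing_by exact F.height_insert_lt hσ n.2

/-- The successors whose values generate the ideal `limitSet g σ`. -/
def IsGenerator (g : F.carrier → Q) (σ : Finset ℕ) (n : ℕ) : Prop :=
  (∀ m ∈ σ, m < n) ∧ n ∈ base F.carrier ∧
    ∀ᶠ m in F.ultrafilter, limitSet g (insert n σ) ≤ limitSet g (insert m σ)

theorem limitSet_leaf (g : F.carrier → Q) {σ : Finset ℕ} (hσ : σ ∈ F.carrier) :
    limitSet g σ = atom (g ⟨σ, hσ⟩) := by
  rw [limitSet, dif_neg (F.notMem_tree hσ), dif_pos hσ]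

theorem not_isAtom_limitSet (g : F.carrier → Q) {σ : Finset ℕ} (hσ : σ ∈ tree F.carrier) :
    ¬ (limitSet g σ).IsAtom := by
  rw [limitSet, dif_pos hσ]
  exact not_isAtom_ofFamily _

theorem mem_limitSet (g : F.carrier → Q) {σ : Finset ℕ} (hσ : σ ∈ tree F.carrier)
    {y : USet.{u, v} Q} :
    y ∈ limitSet g σ ↔ ∃ n, IsGenerator g σ n ∧ y = limitSet g (insert n σ) := by
  rw [limitSet, dif_pos hσ, mem_ofFamily]
  constructor
  · rintro ⟨⟨⟨⟨n, hn⟩, hb, h⟩⟩, rfl⟩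
    exact ⟨n, ⟨hn, hb, h.mono fun m hm => hm.2⟩, rfl⟩
  · rintro ⟨n, ⟨hn, hb, h⟩, rfl⟩
    refine ⟨⟨⟨⟨n, hn⟩, hb, ?_⟩⟩, rfl⟩
    filter_upwards [h, F.eventually_gt σ] with m h₁ h₂ using ⟨h₂, h₁⟩

/-- Both claims go by one induction on height: the successor values lie in `IDot Q α` by induction,
so the wqo hypothesis makes almost all of them generators. In particular the limit set is non-empty,
which puts a urelement in its transitive closure. -/
theorem limitSet_mem_IDot {α : Ordinal.{v}} (hα : F.rank ≤ α)
    (hw : WellQuasiOrdered fun x y : IDot Q α => x ≤ y) (g : F.carrier → Q) (σ : Finset ℕ) :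
    limitSet g σ ∈ IDot Q (F.height σ) ∧
      (σ ∈ tree F.carrier → ∀ᶠ n in F.ultrafilter, IsGenerator g σ n) := by
  induction h : F.height σ using WellFoundedLT.induction generalizing σ with
  | ind γ ih =>
  subst h
  by_cases hσ : σ ∈ tree F.carrier
  · have hsucc : ∀ n, (∀ m ∈ σ, m < n) →
        limitSet g (insert n σ) ∈ IDot Q (F.height (insert n σ)) :=
      fun n hn => (ih _ (F.height_insert_lt hσ hn) _ rfl).1
    have hgen : ∀ᶠ n in F.ultrafilter, IsGenerator g σ n := by
      have hev := eventually_eventually_le_of_wellQuasiOrdered hw F.ultrafilter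
        (x := fun n => limitSet g (insert n σ)) (by
          filter_upwards [F.eventually_gt σ] with n hn
          exact IDot_mono (((F.height_insert_le hσ hn).trans (F.rk_le_rank hσ)).trans hα)
            (hsucc n hn))
      filter_upwards [hev, F.eventually_gt σ, F.eventually_mem_base] with n h₁ h₂ h₃
        using ⟨h₂, h₃, h₁⟩
    refine ⟨mem_IDot.2 (Or.inr ⟨⟨?_, Or.inr ?_⟩, ?_, ?_⟩), fun _ => hgen⟩
    · obtain ⟨n, hn⟩ := hgen.exists
      obtain ⟨q, hq⟩ := mem_VDot_of_mem_IDot (hsucc n hn.1)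
      exact ⟨q, hq.tail ((mem_limitSet g hσ).2 ⟨n, hn, rfl⟩)⟩
    · rw [Front.height, dif_pos hσ, Order.lt_succ_iff, rank_le_iff (not_isAtom_limitSet g hσ)]
      intro y hy hya
      obtain ⟨n, hn, rfl⟩ := (mem_limitSet g hσ).1 hy
      exact (rank_lt_of_mem_IDot (hsucc n hn.1) hya).trans_le (F.height_insert_le hσ hn.1)
    · intro y hy
      obtain ⟨n, hn, rfl⟩ := (mem_limitSet g hσ).1 hy
      exact ⟨_, F.height_insert_lt hσ hn.1, hsucc n hn.1⟩
    · intro y hy z hz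
      obtain ⟨n, hn, rfl⟩ := (mem_limitSet g hσ).1 hy
      obtain ⟨m, hm, rfl⟩ := (mem_limitSet g hσ).1 hz
      -- Two generators lie below almost all successor values, and almost all successors are
      -- generators, so some generator bounds both.
      obtain ⟨k, ⟨hnk, hmk⟩, hk⟩ := ((hn.2.2.and hm.2.2).and hgen).exists
      exact ⟨_, (mem_limitSet g hσ).2 ⟨k, hk, rfl⟩, hnk, hmk⟩
  · refine ⟨?_, fun h => absurd h hσ⟩
    rw [limitSet, dif_neg hσ]
    split_ifs <;> exact atom_mem_IDot _ _

/-- The left half of one step of the walk: an inner node moves to the successor prepared in advance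
by the generator `n`, a leaf stays put. -/
theorem exists_isComponent_limitSet {g : F.carrier → Q} {a n : ℕ} {υ σ : Finset ℕ}
    (haσ : a ∈ σ) (hσm : σ ∈ tree F.carrier ∨ σ ∈ F.carrier) (hσi : IsInit σ ↑(insert a υ))
    (hσt : σ ∈ tree F.carrier → insert n σ = insert a υ ∧ IsGenerator g σ n) :
    ∃ σ', IsComponent (limitSet g σ') (limitSet g σ) ∧ a ∈ σ' ∧
      (σ' ∈ tree F.carrier ∨ σ' ∈ F.carrier) ∧ IsInit σ' ↑(insert a υ) ∧
      (σ' ∈ tree F.carrier → σ' = insert a υ) ∧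
      (σ ∈ tree F.carrier → F.height σ' < F.height σ) ∧ (σ ∈ F.carrier → σ' = σ) := by
  rcases hσm with hσ | hσ
  · obtain ⟨he, hn⟩ := hσt hσ
    refine ⟨insert n σ, Or.inr ((mem_limitSet g hσ).2 ⟨n, hn, rfl⟩), Finset.mem_insert_of_mem haσ,
      F.insert_mem hσ hn.2.1 hn.1, he ▸ IsInit.refl _, fun _ => he,
      fun _ => F.height_insert_lt hσ hn.1, fun h => absurd hσ (F.notMem_tree h)⟩
  · refine ⟨σ, ?_, haσ, Or.inr hσ, hσi, fun h => absurd h (F.notMem_tree hσ),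
      fun h => absurd h (F.notMem_tree hσ), fun _ => rfl⟩
    rw [limitSet_leaf g hσ]
    exact (isAtom_atom _).isComponent

/-- The right half of the step. The component above `x` may come from an uncontrolled successor `k`
of `τ`, but `k` is a generator, so its value lies below that of `insert m τ` for almost every `m`.
-/
theorem eventually_exists_isComponent_limitSet {g : F.carrier → Q} {υ τ : Finset ℕ}
    {x y : USet.{u, v} Q} (hτ : τ.Nonempty) (hτm : τ ∈ tree F.carrier ∨ τ ∈ F.carrier)
    (hτi : IsInit τ υ) (hτt : τ ∈ tree F.carrier → τ = υ) (hy : IsComponent y (limitSet g τ))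
    (hxy : x ≤ y) :
    ∀ᶠ m in F.ultrafilter, ∃ τ', x ≤ limitSet g τ' ∧ τ'.Nonempty ∧
      (τ' ∈ tree F.carrier ∨ τ' ∈ F.carrier) ∧ IsInit τ' ↑(insert m υ) ∧
      (τ' ∈ tree F.carrier → τ' = insert m υ) ∧
      (τ ∈ tree F.carrier → F.height τ' < F.height τ) := by
  rcases hτm with hτm | hτm
  · obtain rfl := hτt hτm
    obtain ⟨k, hk, rfl⟩ := (mem_limitSet g hτm).1 (hy.mem (not_isAtom_limitSet g hτm))
    filter_upwards [hk.2.2, F.eventually_gt τ, F.eventually_mem_base] with m h₁ h₂ h₃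
    exact ⟨insert m τ, hxy.trans h₁, Finset.insert_nonempty _ _, F.insert_mem hτm h₃ h₂,
      IsInit.refl _, fun _ => rfl, fun _ => F.height_insert_lt hτm h₂⟩
  · filter_upwards [F.eventually_gt υ] with m hm
    rw [limitSet_leaf g hτm] at hy
    obtain rfl := hy.eq_of_isAtom (isAtom_atom _)
    exact ⟨τ, (limitSet_leaf g hτm).symm ▸ hxy, hτ, Or.inr hτm, hτi.trans (isInit_insert hm),
      fun h => absurd h (F.notMem_tree hτm), fun h => absurd h (F.notMem_tree hτm)⟩

theorem triangle_of_isInit {a : ℕ} {υ σ τ : Finset ℕ} (ha : ∀ m ∈ υ, a < m) (haσ : a ∈ σ)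
    (hτ : τ.Nonempty) (hσi : IsInit σ ↑(insert a υ)) (hτi : IsInit τ υ) : Triangle σ τ := by
  have hmin : σ.min' ⟨a, haσ⟩ = a := by
    refine le_antisymm (Finset.min'_le _ _ haσ) (Finset.le_min' _ _ _ fun m hm => ?_)
    rcases Finset.mem_insert.1 (hσi.subset hm) with rfl | h
    · exact le_rfl
    · exact (ha m h).le
  have herase : IsInit (σ.erase a) υ := by
    refine ⟨fun m hm => ?_, fun k hk m hm hkm => ?_⟩
    · obtain ⟨hne, hm⟩ := Finset.mem_erase.1 (Finset.mem_coe.1 hm)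
      exact (Finset.mem_insert.1 (hσi.subset hm)).resolve_left hne
    · exact Finset.mem_erase.2 ⟨(ha k hk).ne', hσi.2 k (Finset.mem_insert_of_mem hk) m
        (Finset.mem_of_mem_erase hm) hkm⟩
  refine ⟨⟨a, haσ⟩, hτ, ?_, ?_⟩
  · rw [hmin]
    exact ha _ (hτi.subset (Finset.min'_mem _ _))
  · rw [hmin]
    exact herase.total hτi

/-- Invariant of the walk: `υ` lists the numbers chosen after `a`, `τ` follows `υ`, and `σ` follows
`insert a υ` one number behind, until each gets stuck at a leaf. The lag lets the same number `m`
extend `τ` now and `σ` at the next step. When both are leaves, `σ ◁ τ` holds because they are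
initial in `insert a υ` and `υ`. -/
theorem exists_le_of_limitSet_le {g : F.carrier → Q}
    (hgen : ∀ σ ∈ tree F.carrier, ∀ᶠ n in F.ultrafilter, IsGenerator g σ n)
    (a n : ℕ) (υ σ τ : Finset ℕ) (ha : ∀ m ∈ υ, a < m) (haσ : a ∈ σ) (hτ : τ.Nonempty)
    (hσm : σ ∈ tree F.carrier ∨ σ ∈ F.carrier) (hτm : τ ∈ tree F.carrier ∨ τ ∈ F.carrier)
    (hσi : IsInit σ ↑(insert a υ)) (hτi : IsInit τ υ)
    (hσt : σ ∈ tree F.carrier → insert n σ = insert a υ ∧ IsGenerator g σ n)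
    (hτt : τ ∈ tree F.carrier → τ = υ) (hle : limitSet g σ ≤ limitSet g τ) :
    ∃ σ τ : F.carrier, Triangle σ.1 τ.1 ∧ g σ ≤ g τ := by
  by_cases hleaf : σ ∈ F.carrier ∧ τ ∈ F.carrier
  · obtain ⟨hσ, hτ'⟩ := hleaf
    rw [limitSet_leaf g hσ, limitSet_leaf g hτ', atom_le_atom] at hle
    exact ⟨⟨σ, hσ⟩, ⟨τ, hτ'⟩, triangle_of_isInit ha haσ hτ hσi hτi, hle⟩
  obtain ⟨σ', hσc, haσ', hσm', hσi', hσt', hlt, heq⟩ :=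
    exists_isComponent_limitSet haσ hσm hσi hσt
  obtain ⟨y, hy, hle'⟩ := le_iff_isComponent.1 hle _ hσc
  have hm : ∀ᶠ m in F.ultrafilter, σ' ∈ tree F.carrier → IsGenerator g σ' m := by
    by_cases h : σ' ∈ tree F.carrier
    · filter_upwards [hgen _ h] with m hm _ using hm
    · exact Eventually.of_forall fun m hc => absurd hc h
  obtain ⟨m, ⟨⟨τ', hle'', hτ', hτm', hτi', hτt', hlt'⟩, hm⟩, hgt⟩ :=
    (((eventually_exists_isComponent_limitSet hτ hτm hτi hτt hy hle').and hm).and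
      (F.eventually_gt (insert a υ))).exists
  -- An inner `σ` loses height whatever happens to `τ`; if `σ` is a leaf it stays, and `τ` is still
  -- an inner node and loses height.
  have hdec : Prod.Lex (· < ·) (· < ·) (F.height σ', F.height τ') (F.height σ, F.height τ) := by
    rcases hσm with hσ | hσ
    · exact Prod.Lex.left _ _ (hlt hσ)
    · rw [heq hσ]
      exact Prod.Lex.right _ (hlt' (hτm.resolve_right fun h => hleaf ⟨hσ, h⟩))
  refine exists_le_of_limitSet_le hgen a m (insert m υ) σ' τ' ?_ haσ' hτ' hσm' hτm' ?_ hτi'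
    (fun h => ⟨?_, hm h⟩) hτt' hle''
  · intro k hk
    rcases Finset.mem_insert.1 hk with rfl | hk
    · exact hgt a (Finset.mem_insert_self _ _)
    · exact ha k hk
  · rw [Finset.insert_comm]
    exact hσi'.trans (isInit_insert hgt)
  · rw [hσt' h, Finset.insert_comm]
termination_by (F.height σ, F.height τ)
decreasing_by exact hdec

theorem not_isBad_of_wellQuasiOrdered {α : Ordinal.{v}} (hα : F.rank ≤ α)
    (hw : WellQuasiOrdered fun x y : IDot Q α => x ≤ y) (g : F.carrier → Q) : ¬ IsBad F g := by
  intro hbad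
  have hgen : ∀ σ ∈ tree F.carrier, ∀ᶠ n in F.ultrafilter, IsGenerator g σ n :=
    fun σ => (limitSet_mem_IDot hα hw g σ).2
  have hempty := F.empty_mem_tree
  have hsing : ∀ n ∈ base F.carrier, {n} ∈ tree F.carrier ∨ {n} ∈ F.carrier :=
    fun n hn => F.insert_mem hempty hn (by simp)
  -- A generator `a` of the root has its value below that at `{b}` for almost all `b`; among these
  -- `b` is also taken to be a generator at `{a}`, if `{a}` is not yet a leaf.
  obtain ⟨a, -, hab, ha⟩ := (hgen ∅ hempty).exists
  have hb : ∀ᶠ b in F.ultrafilter, {a} ∈ tree F.carrier → IsGenerator g {a} b := by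
    by_cases h : {a} ∈ tree F.carrier
    · filter_upwards [hgen _ h] with b hb _ using hb
    · exact Eventually.of_forall fun b hc => absurd hc h
  obtain ⟨b, ⟨⟨hle, hlt⟩, hbb⟩, hb⟩ :=
    (((ha.and (F.eventually_gt {a})).and F.eventually_mem_base).and hb).exists
  replace hlt := hlt a (Finset.mem_singleton_self a)
  obtain ⟨σ, τ, h, h'⟩ := exists_le_of_limitSet_le hgen a b {b} {a} {b} (by simpa using hlt)
    (Finset.mem_singleton_self a) (Finset.singleton_nonempty b) (hsing a hab) (hsing b hbb)
    (by
      rw [Finset.pair_comm]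
      exact isInit_insert (by simpa using hlt))
    (IsInit.refl _) (fun h => ⟨Finset.pair_comm _ _, hb h⟩) (fun _ => rfl) hle
  exact hbad σ τ h h'

end Ascent

/-! ### The equivalences -/

theorem wellQuasiOrdered_IDot_iff {Q : Type u} [Preorder Q] (α : Ordinal.{v}) :
    WellQuasiOrdered (fun x y : IDot Q α => x ≤ y) ↔
      ¬ ∃ (F : Front.{v}) (g : F.carrier → Q), F.rank ≤ α ∧ IsBad F g := by
  constructor
  · rintro hw ⟨F, g, hα, hg⟩
    exact not_isBad_of_wellQuasiOrdered hα hw g hg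
  · intro h x
    by_contra! hx
    exact h (exists_isBad_of_badSeq (x := fun n => (x n).1) hx fun n => (x n).2)

theorem wellFoundedLT_of_wellQuasiOrdered_IDot {Q : Type u} [Preorder Q] {α : Ordinal.{v}}
    (hw : WellQuasiOrdered (fun x y : IDot Q α => x ≤ y)) : WellFoundedLT Q := by
  -- The urelements form a copy of `Q` inside `IDot Q α`.
  have : WellQuasiOrderedLE Q := ⟨fun f => hw fun n => ⟨atom (f n), atom_mem_IDot α _⟩⟩
  infer_instance

end IterIdeal

theorem mainTheorem2 {Q : Type u} [Preorder Q] :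
    (∀ α : Ordinal.{v},
      WellQuasiOrdered (fun x y : IterIdeal.IDot Q α => x ≤ y) ↔
        ¬ ∃ (F : IterIdeal.Front.{v}) (g : F.carrier → Q),
          F.rank ≤ α ∧ IterIdeal.IsBad F g) ∧
    (IterIdeal.IsBqo.{u, v} Q ↔
      ∀ α : Ordinal.{v}, WellQuasiOrdered (fun x y : IterIdeal.IDot Q α => x ≤ y)) := by
  refine ⟨IterIdeal.wellQuasiOrdered_IDot_iff, fun h α => ?_, fun h α => ⟨?_, ?_⟩⟩
  · rw [IterIdeal.wellQuasiOrdered_IDot_iff]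
    rintro ⟨F, g, hF, hg⟩
    -- The successor turns rank `≤ α` into the strict bound in the definition of an `α`-wqo.
    exact (h (Order.succ α)).2 F (Order.lt_succ_of_le hF) ⟨g, hg⟩
  · exact IterIdeal.wellFoundedLT_of_wellQuasiOrdered_IDot (h 0)
  · rintro F hF ⟨g, hg⟩
    exact (IterIdeal.wellQuasiOrdered_IDot_iff α).1 (h α) ⟨F, g, hF.le, hg⟩
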